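/- Let $J_0, Y_0$ be the Bessel functions of the first and second kind of order zero, $H_0^{(1)}=J_0+\mathrm{i}Y_0$ the Hankel function, and $H_0(t):=\mathrm{i}H_0^{(1)}(\mathrm{i}t)$ for $t>0$ (a real number). Let $a>0$ and $\tau\ge 6$, and put $k_0:=\frac{\pi}{30a}$. For integers $N\ge 1$ let $$\mathbb{K}_N:=\Big\{\tfrac{\pi}{a}|\boldsymbol l| : \boldsymbol l\in\mathbb{Z}^2,\ 1\le|\boldsymbol l|_\infty\le N\Big\}\cup\{k_0\}.$$ For $k\in\mathbb{K}_N$ put $$R=\tau a,\quad \lambda_1=\tfrac12,\quad \lambda_2=\tfrac12+\tfrac{\pi}{2kR}\quad\text{if }k\neq k_0;\qquad R=6a,\quad \lambda_1=\tfrac12,\quad \lambda_2=-\tfrac32\quad\text{if }k=k_0.$$ For an integer $m\ge 10$ and $j\in\{1,\dots,m\}$ let $\vartheta_i=i\pi/m$, let $\Gamma_j=\{R(\cos\vartheta,\sin\vartheta):\vartheta_{2j-2}\le\vartheta\le\vartheta_{2j}\}$, and let $z_{j,\ell}=\lambda_\ell R(\cos\vartheta_{2j-1},\sin\vartheta_{2j-1})$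 for $\ell=1,2$. For $x\in\Gamma_j$ and $\ell=1,2$ write $r_{j,\ell}=|x-z_{j,\ell}|$ and, for $\square\in\{\mathcal I,\Delta\}$ (identity or Laplacian), $$A_{j,\ell,k}^{\mathcal I}=\tfrac{1}{k^2}\big(Y_0(kr_{j,\ell})+H_0(kr_{j,\ell})\big),\quad B_{j,\ell,k}^{\mathcal I}=-\tfrac1{k^2}J_0(kr_{j,\ell}),\quad A_{j,\ell,k}^{\Delta}=H_0(kr_{j,\ell})-Y_0(kr_{j,\ell}),\quad B_{j,\ell,k}^{\Delta}=J_0(kr_{j,\ell}),$$ $$D_{j,k}^\square=\begin{bmatrix}A_{j,1,k}^\square & B_{j,1,k}^\square\\ A_{j,2,k}^\square & B_{j,2,k}^\square\end{bmatrix}.$$ Let $p=5$ if $\square=\mathcal I$ and $p=1$ if $\square=\Delta$. Then there is a constant $C>0$, depending only on $a$ and $\tau$, such that for both choices of $\square$, all integers $m\ge 10$ and $N\ge1$, all $k\in\mathbb{K}_N$, all $j\in\{1,\dots,m\}$ and all $x\in\Gamma_j$, $$\big|\det D_{j,k}^\square\big|\ge C\,k^{-p}.$$ Consequently, for all such $\square,m,N,k,j,x$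 and every right-hand side $(f_1,f_2)\in\mathbb{R}^2$, the phase-retrieval system $$A_{j,\ell,k}^\square\,\xi+B_{j,\ell,k}^\square\,\eta=f_\ell,\qquad \ell=1,2,$$ has exactly one solution $(\xi,\eta)\in\mathbb{R}^2$. -/

import Mathlib

noncomputable section

namespace PhaseRetrieval

/-- The Bessel function `J₀(z) = ∑ (-1)ⁿ (z/2)²ⁿ / (n!)²`. -/
def besselJ0 (z : ℂ) : ℂ :=
  ∑' n : ℕ, (-1) ^ n * (z ^ 2 / 4) ^ n / ((n.factorial : ℂ) ^ 2)

/-- The Bessel function of the second kind `Y₀` (principal branch):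
`Y₀(z) = (2/π) (log (z/2) + γ) J₀(z) - (2/π) ∑ (-1)ⁿ hₙ (z²/4)ⁿ / (n!)²`, where `γ` is the
Euler–Mascheroni constant and `hₙ = 1 + 1/2 + ⋯ + 1/n`. -/
def besselY0 (z : ℂ) : ℂ :=
  2 / (Real.pi : ℂ) * (Complex.log (z / 2) + (Real.eulerMascheroniConstant : ℂ)) * besselJ0 z
    - 2 / (Real.pi : ℂ) *
      ∑' n : ℕ, (-1) ^ n * ((harmonic n : ℚ) : ℂ) * (z ^ 2 / 4) ^ n / ((n.factorial : ℂ) ^ 2)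

/-- The Hankel function of the first kind and order zero, `H₀⁽¹⁾ = J₀ + i Y₀`. -/
def hankelH10 (z : ℂ) : ℂ := besselJ0 z + Complex.I * besselY0 z

/-- `J₀` on the positive half-line; the complex value there is real, see `besselJ0_ofReal`. -/
def J0 (t : ℝ) : ℝ := (besselJ0 t).re

/-- `Y₀` on the positive half-line; the complex value there is real, see `besselY0_ofReal`. -/
def Y0 (t : ℝ) : ℝ := (besselY0 t).re

/-- `H₀(t) = i H₀⁽¹⁾(i t)` on the positive half-line; the complex value there is real, see
`I_mul_hankelH10_I_mul`. -/
def H0 (t : ℝ) : ℝ := (Complex.I * hankelH10 (Complex.I * t)).re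

theorem besselJ0_im_of_sq_real {z : ℂ} {s : ℝ} (hz : z ^ 2 = (s : ℂ)) : (besselJ0 z).im = 0 := by
  have h : besselJ0 z = ((∑' n : ℕ, (-1) ^ n * (s / 4) ^ n / ((n.factorial : ℝ) ^ 2) : ℝ) : ℂ) := by
    rw [besselJ0, hz, Complex.ofReal_tsum]
    congr 1
    funext n
    push_cast
    rfl
  rw [h, Complex.ofReal_im]

theorem besselY0_tail_im_of_sq_real {z : ℂ} {s : ℝ} (hz : z ^ 2 = (s : ℂ)) :
    (∑' n : ℕ, (-1) ^ n * ((harmonic n : ℚ) : ℂ) * (z ^ 2 / 4) ^ n /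
      ((n.factorial : ℂ) ^ 2)).im = 0 := by
  have h : (∑' n : ℕ, (-1) ^ n * ((harmonic n : ℚ) : ℂ) * (z ^ 2 / 4) ^ n /
      ((n.factorial : ℂ) ^ 2)) =
      ((∑' n : ℕ, (-1) ^ n * ((harmonic n : ℚ) : ℝ) * (s / 4) ^ n /
        ((n.factorial : ℝ) ^ 2) : ℝ) : ℂ) := by
    rw [hz, Complex.ofReal_tsum]
    congr 1
    funext n
    push_cast
    rfl
  rw [h, Complex.ofReal_im]

theorem besselJ0_ofReal (t : ℝ) : besselJ0 (t : ℂ) = (J0 t : ℂ) := by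
  apply Complex.ext
  · simp [J0]
  · rw [Complex.ofReal_im]
    exact besselJ0_im_of_sq_real (s := t ^ 2) (by push_cast; rfl)

theorem besselY0_ofReal {t : ℝ} (ht : 0 < t) : besselY0 (t : ℂ) = (Y0 t : ℂ) := by
  apply Complex.ext
  · simp [Y0]
  · have hz : (t : ℂ) ^ 2 = ((t ^ 2 : ℝ) : ℂ) := by push_cast; rfl
    have h1 := besselJ0_im_of_sq_real hz
    have h2 := besselY0_tail_im_of_sq_real hz
    have hl : Complex.log ((t : ℂ) / 2) = ((Real.log (t / 2) : ℝ) : ℂ) := by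
      rw [Complex.ofReal_log (by positivity)]
      push_cast
      rfl
    have hp : (2 / (Real.pi : ℂ)) = ((2 / Real.pi : ℝ) : ℂ) := by push_cast; rfl
    rw [besselY0, hl, hp, Complex.ofReal_im]
    simp only [Complex.sub_im, Complex.mul_im, Complex.mul_re, Complex.add_im, Complex.add_re,
      Complex.ofReal_im, Complex.ofReal_re, h1, h2]
    ring

theorem I_mul_hankelH10_I_mul {t : ℝ} (ht : 0 < t) :
    Complex.I * hankelH10 (Complex.I * (t : ℂ)) = (H0 t : ℂ) := by
  apply Complex.ext
  · simp [H0]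
  · have hz : (Complex.I * (t : ℂ)) ^ 2 = ((-t ^ 2 : ℝ) : ℂ) := by
      rw [mul_pow, Complex.I_sq]; push_cast; ring
    have h1 := besselJ0_im_of_sq_real hz
    have h2 := besselY0_tail_im_of_sq_real hz
    have hl : Complex.log (Complex.I * (t : ℂ) / 2)
        = ((Real.log (t / 2) : ℝ) : ℂ) + ((Real.pi / 2 : ℝ) : ℂ) * Complex.I := by
      have : Complex.I * (t : ℂ) / 2 = ((t / 2 : ℝ) : ℂ) * Complex.I := by push_cast; ring
      rw [this, Complex.log_ofReal_mul (by positivity) Complex.I_ne_zero, Complex.log_I]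
      push_cast
      rfl
    have hp : (2 / (Real.pi : ℂ)) = ((2 / Real.pi : ℝ) : ℂ) := by push_cast; rfl
    have hpi := Real.pi_ne_zero
    rw [hankelH10, besselY0, hl, hp, Complex.ofReal_im]
    simp only [Complex.sub_im, Complex.sub_re, Complex.mul_im, Complex.mul_re, Complex.add_im,
      Complex.add_re, Complex.ofReal_im, Complex.ofReal_re, Complex.I_re, Complex.I_im, h1, h2]
    field_simp
    ring

/-- The small wave number `k₀ = π / (30 a)`. -/
def k0 (a : ℝ) : ℝ := Real.pi / (30 * a)

/-- The admissible wave numbers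
`𝕂_N = {(π/a) |l| : l ∈ ℤ², 1 ≤ |l|_∞ ≤ N} ∪ {k₀}`, with `|l|` the Euclidean norm. -/
def admissible (a : ℝ) (N : ℕ) : Set ℝ :=
  {k | ∃ l₁ l₂ : ℤ, 1 ≤ max |l₁| |l₂| ∧ max |l₁| |l₂| ≤ (N : ℤ) ∧
    k = Real.pi / a * Real.sqrt ((l₁ : ℝ) ^ 2 + (l₂ : ℝ) ^ 2)} ∪ {k0 a}

/-- The measurement radius: `6 a` at `k = k₀`, and `τ a` at the other wave numbers. -/
def radius (a τ k : ℝ) : ℝ := if k = k0 a then 6 * a else τ * a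

/-- The position parameters `λ_{j,1}, λ_{j,2}` (they do not depend on `j`). -/
def lam (a τ k : ℝ) : Fin 2 → ℝ :=
  ![1 / 2, if k = k0 a then -3 / 2 else 1 / 2 + Real.pi / (2 * k * radius a τ k)]

/-- The angles `ϑ_i = i π / m`. -/
def theta (m : ℕ) (i : ℝ) : ℝ := i * Real.pi / m

/-- The point of the plane with polar coordinates `(r, ϑ)` (`r` may be negative). -/
def polar (r ϑ : ℝ) : EuclideanSpace ℝ (Fin 2) := !₂[r * Real.cos ϑ, r * Real.sin ϑ]

/-- The arc `Γ_j = {R (cos ϑ, sin ϑ) : ϑ_{2j-2} ≤ ϑ ≤ ϑ_{2j}}`. -/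
def arc (R : ℝ) (m j : ℕ) : Set (EuclideanSpace ℝ (Fin 2)) :=
  polar R '' Set.Icc (theta m (2 * j - 2)) (theta m (2 * j))

/-- The auxiliary source points `z_{j,ℓ} = λ_{j,ℓ} R (cos ϑ_{2j-1}, sin ϑ_{2j-1})`. -/
def source (a τ k : ℝ) (m j : ℕ) (ℓ : Fin 2) : EuclideanSpace ℝ (Fin 2) :=
  polar (lam a τ k ℓ * radius a τ k) (theta m (2 * j - 1))

/-- The choice of `□`: the identity or the Laplacian. -/
inductive Op
  | ident
  | laplacian

/-- The exponent `p`: `5` for the identity, `1` for the Laplacian. -/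
def Op.exponent : Op → ℕ
  | .ident => 5
  | .laplacian => 1

/-- The coefficient `A^□` at distance `r` from the source. -/
def coeffA (op : Op) (k r : ℝ) : ℝ :=
  match op with
  | .ident => 1 / k ^ 2 * (Y0 (k * r) + H0 (k * r))
  | .laplacian => H0 (k * r) - Y0 (k * r)

/-- The coefficient `B^□` at distance `r` from the source. -/
def coeffB (op : Op) (k r : ℝ) : ℝ :=
  match op with
  | .ident => -(1 / k ^ 2) * J0 (k * r)
  | .laplacian => J0 (k * r)

/-- The coefficient matrix `D_{j,k}^□` at the point `x`: its `ℓ`-th row is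
`(A_{j,ℓ,k}^□, B_{j,ℓ,k}^□)`, evaluated at `r_{j,ℓ} = |x - z_{j,ℓ}|`. -/
def coeffMatrix (op : Op) (a τ k : ℝ) (m j : ℕ) (x : EuclideanSpace ℝ (Fin 2)) :
    Matrix (Fin 2) (Fin 2) ℝ :=
  Matrix.of fun ℓ => ![coeffA op k (dist x (source a τ k m j ℓ)),
    coeffB op k (dist x (source a τ k m j ℓ))]

end PhaseRetrieval

end

noncomputable section

namespace PhaseRetrieval

open Real Set Filter Topology

/-! Up to sign and a factor `k⁻⁴` (identity) or `1` (Laplacian), the determinant is `detCore σ q p`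
with `σ = ±1`, where `q` and `p` are the arguments `k r` belonging to the two sources. It therefore
suffices to bound `|detCore|` below by `C / k`.

For `k ≥ π / a` the second source is shifted by `π / (2k)` along the axis, so the two phases differ
by nearly a quarter period: `distance_gap` puts `q - p` between `0.37 π` and `π / 2`. As a function
of `p`, the cross product `J₀(q) Y₀(p) - Y₀(q) J₀(p)` solves Bessel's equation, vanishes at `q`, and
has its slope there fixed by the Wronskian. It thus behaves like a constant times `sin (q - p) / q`
(`bessel_solution_lower_bound`). The `H₀` terms consume at most half of this, because `H₀ = (2/π)
K₀` decays and `|J₀| ≤ 1`. Finally `q ≤ k R`.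

At `k₀` the arguments lie in two short intervals independent of `a`, and Taylor polynomials with
explicit remainders settle the signs.

The analytic input comes from the defining series: the differential equations, the Wronskians, and
the bound `K₀ ≤ 1 / (2 I₀)` on `[2, ∞)`, obtained by comparing derivatives of functions that vanish
at infinity. -/

/-! ### Power series dominated by the exponential series -/

/-- The sum of a real power series. -/
def seriesSum (c : ℕ → ℝ) (y : ℝ) : ℝ := ∑' n, c n * y ^ n

/-- The coefficients of the derivative of a power series. -/
def derivCoeff (c : ℕ → ℝ) (n : ℕ) : ℝ := (n + 1) * c (n + 1)

/-- Coefficients dominated by those of the exponential series. -/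
def ExpBounded (c : ℕ → ℝ) : Prop := ∀ n, |c n| ≤ 1 / (n.factorial : ℝ)

theorem ExpBounded.derivCoeff {c : ℕ → ℝ} (hc : ExpBounded c) : ExpBounded (derivCoeff c) := by
  intro n
  have h := hc (n + 1)
  have hp : (0 : ℝ) < n + 1 := by positivity
  rw [PhaseRetrieval.derivCoeff, abs_mul, abs_of_pos hp]
  calc ((n : ℝ) + 1) * |c (n + 1)| ≤ (n + 1) * (1 / ((n + 1).factorial : ℝ)) := by gcongr
    _ = 1 / (n.factorial : ℝ) := by
      rw [Nat.factorial_succ]; push_cast; field_simp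

theorem ExpBounded.abs_term_le {c : ℕ → ℝ} (hc : ExpBounded c) (y : ℝ) (n : ℕ) :
    |c n * y ^ n| ≤ |y| ^ n / (n.factorial : ℝ) := by
  rw [abs_mul, abs_pow]
  calc |c n| * |y| ^ n ≤ 1 / (n.factorial : ℝ) * |y| ^ n := by gcongr; exact hc n
    _ = _ := by ring

theorem ExpBounded.summable {c : ℕ → ℝ} (hc : ExpBounded c) (y : ℝ) :
    Summable fun n => c n * y ^ n :=
  Summable.of_norm_bounded (Real.summable_pow_div_factorial |y|) fun n => hc.abs_term_le y n

theorem ExpBounded.hasDerivAt {c : ℕ → ℝ} (hc : ExpBounded c) (y : ℝ) :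
    HasDerivAt (seriesSum c) (seriesSum (PhaseRetrieval.derivCoeff c) y) y := by
  set r := |y| + 1 with hr
  have hr0 : 0 < r := by positivity
  have hterm : ∀ n (z : ℝ), |z| ≤ r → ‖c n * (n * z ^ (n - 1))‖ ≤ |c n| * (n * r ^ (n - 1)) := by
    intro n z hz
    rw [Real.norm_eq_abs, abs_mul, abs_mul, abs_pow, Nat.abs_cast]
    gcongr
  have hu : Summable fun n : ℕ => |c n| * (n * r ^ (n - 1)) := by
    rw [← summable_nat_add_iff 1]
    refine (hc.derivCoeff.summable r).abs.congr fun n => ?_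
    rw [PhaseRetrieval.derivCoeff, abs_mul, abs_mul, abs_of_pos (by positivity : (0 : ℝ) < n + 1),
      abs_of_pos (pow_pos hr0 n)]
    push_cast
    ring
  have key := hasDerivAt_tsum_of_isPreconnected (t := Metric.ball (0 : ℝ) r)
    (g := fun n z => c n * z ^ n) (g' := fun n z => c n * (n * z ^ (n - 1)))
    (y₀ := y) (y := y) hu Metric.isOpen_ball (convex_ball _ _).isPreconnected
    (fun n z _ => (hasDerivAt_pow n z).const_mul (c n))
    (fun n z hz => hterm n z (by simpa using (Metric.mem_ball.1 hz).le))
    (by simp [hr]) (hc.summable y) (by simp [hr])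
  convert! key using 1
  rw [seriesSum, Summable.tsum_eq_zero_add
    (Summable.of_norm_bounded hu fun n => hterm n y (by simp [hr]))]
  simp only [CharP.cast_eq_zero, zero_mul, mul_zero, zero_add]
  refine tsum_congr fun n => ?_
  rw [PhaseRetrieval.derivCoeff]
  push_cast
  ring

theorem ExpBounded.mul_seriesSum_derivCoeff {c : ℕ → ℝ} (hc : ExpBounded c) (y : ℝ) :
    HasSum (fun n : ℕ => n * c n * y ^ n) (y * seriesSum (PhaseRetrieval.derivCoeff c) y) := by
  have h := (hc.derivCoeff.summable y).hasSum.mul_left y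
  rw [← hasSum_nat_add_iff' 1]
  simp only [Finset.range_one, Finset.sum_singleton, CharP.cast_eq_zero, zero_mul, sub_zero]
  refine h.congr_fun fun n => ?_
  rw [PhaseRetrieval.derivCoeff]
  push_cast
  ring

/-- The tail is at most `|y|³ (e - 5/2)`, and `e - 5/2 < 11/50`. -/
theorem ExpBounded.abs_seriesSum_sub_le {c : ℕ → ℝ} (hc : ExpBounded c) {y : ℝ} (hy : |y| ≤ 1) :
    |seriesSum c y - (c 0 + c 1 * y + c 2 * y ^ 2)| ≤ 11 / 50 * |y| ^ 3 := by
  have hs := hc.summable y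
  have h1 := hs.sum_add_tsum_nat_add 3
  have h2 : seriesSum c y - (c 0 + c 1 * y + c 2 * y ^ 2) = ∑' n, c (n + 3) * y ^ (n + 3) := by
    rw [seriesSum, ← h1]; simp [Finset.sum_range_succ]
  have he : HasSum (fun n : ℕ => 1 / (n.factorial : ℝ)) (Real.exp 1) := by
    have := NormedSpace.expSeries_div_hasSum_exp (𝔸 := ℝ) 1
    rw [← Real.exp_eq_exp_ℝ] at this
    simpa using this
  have he3 : HasSum (fun n : ℕ => |y| ^ 3 * (1 / ((n + 3).factorial : ℝ)))
      (|y| ^ 3 * (Real.exp 1 - 5 / 2)) := by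
    refine HasSum.mul_left _ ?_
    have := (hasSum_nat_add_iff' 3).2 he
    have hval : ∑ i ∈ Finset.range 3, 1 / (i.factorial : ℝ) = 5 / 2 := by
      norm_num [Finset.sum_range_succ]
    rwa [hval] at this
  rw [h2, ← Real.norm_eq_abs]
  refine (tsum_of_norm_bounded he3 fun n => ?_).trans ?_
  · refine (hc.abs_term_le y (n + 3)).trans ?_
    rw [pow_add, mul_comm, ← mul_one_div, mul_assoc]
    exact mul_le_mul_of_nonneg_left (mul_le_of_le_one_left (by positivity)
      (pow_le_one₀ (abs_nonneg _) hy)) (by positivity)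
  · have := Real.exp_one_lt_d9
    rw [mul_comm]
    gcongr
    linarith

/-! ### The two entire series behind the Bessel functions -/

/-- The coefficients `1 / (n!)²`. -/
def coeffI (n : ℕ) : ℝ := 1 / (n.factorial : ℝ) ^ 2

/-- The coefficients `hₙ / (n!)²`, where `hₙ` is the `n`-th harmonic number. -/
def coeffHarm (n : ℕ) : ℝ := (harmonic n : ℝ) / (n.factorial : ℝ) ^ 2

theorem harmonic_nonneg (n : ℕ) : (0 : ℝ) ≤ harmonic n := by
  rw [harmonic]; push_cast; positivity

theorem harmonic_le_factorial (n : ℕ) : (harmonic n : ℝ) ≤ n.factorial := by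
  have h : (harmonic n : ℝ) ≤ n := by
    rw [harmonic]; push_cast
    calc ∑ i ∈ Finset.range n, ((i : ℝ) + 1)⁻¹ ≤ ∑ i ∈ Finset.range n, (1 : ℝ) :=
          Finset.sum_le_sum fun i _ => inv_le_one_of_one_le₀ (by linarith [i.cast_nonneg (α := ℝ)])
      _ = n := by simp
  exact h.trans (by exact_mod_cast n.self_le_factorial)

theorem expBounded_coeffI : ExpBounded coeffI := by
  intro n
  have h : (1 : ℝ) ≤ n.factorial := by exact_mod_cast n.factorial_pos
  rw [coeffI, abs_of_nonneg (by positivity)]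
  gcongr
  nlinarith

theorem expBounded_coeffHarm : ExpBounded coeffHarm := by
  intro n
  have h : (0 : ℝ) < n.factorial := by exact_mod_cast n.factorial_pos
  rw [coeffHarm, abs_of_nonneg (div_nonneg (harmonic_nonneg n) (by positivity)), div_le_div_iff₀
    (by positivity) h]
  nlinarith [harmonic_le_factorial n]

theorem sq_mul_coeffI_succ (n : ℕ) : ((n : ℝ) + 1) ^ 2 * coeffI (n + 1) = coeffI n := by
  rw [coeffI, coeffI, Nat.factorial_succ]; push_cast; field_simp

theorem sq_mul_coeffHarm_succ (n : ℕ) :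
    ((n : ℝ) + 1) ^ 2 * coeffHarm (n + 1) = coeffHarm n + derivCoeff coeffI n := by
  rw [coeffHarm, coeffHarm, derivCoeff, coeffI, harmonic_succ, Nat.factorial_succ]
  push_cast; field_simp

/-- The entire function `A(y) = ∑ yⁿ / (n!)²`. -/
def serA : ℝ → ℝ := seriesSum coeffI

/-- The derivative of `serA`. -/
def serA' : ℝ → ℝ := seriesSum (derivCoeff coeffI)

/-- The second derivative of `serA`. -/
def serA'' : ℝ → ℝ := seriesSum (derivCoeff (derivCoeff coeffI))

/-- The entire function `B(y) = ∑ hₙ yⁿ / (n!)²`. -/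
def serB : ℝ → ℝ := seriesSum coeffHarm

/-- The derivative of `serB`. -/
def serB' : ℝ → ℝ := seriesSum (derivCoeff coeffHarm)

/-- The second derivative of `serB`. -/
def serB'' : ℝ → ℝ := seriesSum (derivCoeff (derivCoeff coeffHarm))

theorem hasDerivAt_serA (y : ℝ) : HasDerivAt serA (serA' y) y := expBounded_coeffI.hasDerivAt y

theorem hasDerivAt_serA' (y : ℝ) : HasDerivAt serA' (serA'' y) y :=
  expBounded_coeffI.derivCoeff.hasDerivAt y

theorem hasDerivAt_serB (y : ℝ) : HasDerivAt serB (serB' y) y := expBounded_coeffHarm.hasDerivAt y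

theorem hasDerivAt_serB' (y : ℝ) : HasDerivAt serB' (serB'' y) y :=
  expBounded_coeffHarm.derivCoeff.hasDerivAt y

theorem hasSum_serA (y : ℝ) : HasSum (fun n => coeffI n * y ^ n) (serA y) :=
  (expBounded_coeffI.summable y).hasSum

theorem hasSum_serA' (y : ℝ) : HasSum (fun n => derivCoeff coeffI n * y ^ n) (serA' y) :=
  (expBounded_coeffI.derivCoeff.summable y).hasSum

theorem hasSum_serB (y : ℝ) : HasSum (fun n => coeffHarm n * y ^ n) (serB y) :=
  (expBounded_coeffHarm.summable y).hasSum

theorem serA_zero : serA 0 = 1 := by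
  rw [serA, seriesSum, tsum_eq_single 0 (by intro n hn; simp [hn])]
  simp [coeffI]

theorem serA_ode (y : ℝ) : y * serA'' y + serA' y = serA y := by
  have h := (expBounded_coeffI.derivCoeff.mul_seriesSum_derivCoeff y).add (hasSum_serA' y)
  refine h.unique ((hasSum_serA y).congr_fun fun n => ?_)
  rw [← sq_mul_coeffI_succ, derivCoeff]
  ring

/-- The extra `serA'` comes from `hₙ₊₁ = hₙ + 1/(n+1)`; it compensates the derivative of the
logarithm in `logSol`. -/
theorem serB_ode (y : ℝ) : y * serB'' y + serB' y = serB y + serA' y := by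
  have h := (expBounded_coeffHarm.derivCoeff.mul_seriesSum_derivCoeff y).add
    (expBounded_coeffHarm.derivCoeff.summable y).hasSum
  refine h.unique (((hasSum_serB y).add (hasSum_serA' y)).congr_fun fun n => ?_)
  rw [← add_mul (coeffHarm n), ← sq_mul_coeffHarm_succ, derivCoeff]
  ring

/-- By the two differential equations the difference of the sides has derivative zero, and it
vanishes at `0`. -/
theorem wronskian_serA_serB (y : ℝ) :
    y * (serA y * serB' y - serA' y * serB y) = (serA y ^ 2 - 1) / 2 := by
  have hd : ∀ z, HasDerivAt (fun z => z * (serA z * serB' z - serA' z * serB z) -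
      (serA z ^ 2 - 1) / 2) 0 z := by
    intro z
    have hA := hasDerivAt_serA z
    have hA' := hasDerivAt_serA' z
    have hB := hasDerivAt_serB z
    have hB' := hasDerivAt_serB' z
    convert! ((hasDerivAt_id z).mul ((hA.mul hB').sub (hA'.mul hB))).sub
      (((hA.pow 2).sub_const 1).div_const 2) using 1
    simp only [id, Pi.mul_apply, Pi.sub_apply]
    linear_combination serB z * serA_ode z - serA z * serB_ode z
  have h := is_const_of_deriv_eq_zero (fun z => (hd z).differentiableAt)
    (fun z => (hd z).deriv) y 0
  simp only [serA_zero] at h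
  linarith

theorem serA_term_nonneg {y : ℝ} (hy : 0 ≤ y) (n : ℕ) : 0 ≤ coeffI n * y ^ n := by
  rw [coeffI]; positivity

theorem partialSum_le_serA {y : ℝ} (hy : 0 ≤ y) : 1 + y + y ^ 2 / 4 ≤ serA y := by
  have := sum_le_hasSum (Finset.range 3) (fun n _ => serA_term_nonneg hy n) (hasSum_serA y)
  simp [Finset.sum_range_succ, coeffI] at this
  linarith

/-! ### Regular and logarithmic solutions of Bessel's equation -/

/-- The logarithmic factor `log (t/2) + γ`. -/
def logTerm (t : ℝ) : ℝ := Real.log (t / 2) + Real.eulerMascheroniConstant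

/-- Assuming only that `z ^ 2` is real covers the real and the imaginary axis at once. -/
theorem besselJ0_of_sq {z : ℂ} {s : ℝ} (hz : z ^ 2 = (s : ℂ)) :
    besselJ0 z = (serA (-(s / 4)) : ℂ) := by
  rw [besselJ0, hz, serA, seriesSum, Complex.ofReal_tsum]
  refine tsum_congr fun n => ?_
  rw [coeffI, neg_eq_neg_one_mul (s / 4), mul_pow]
  push_cast
  ring

theorem besselY0_tail_of_sq {z : ℂ} {s : ℝ} (hz : z ^ 2 = (s : ℂ)) :
    (∑' n : ℕ, (-1) ^ n * ((harmonic n : ℚ) : ℂ) * (z ^ 2 / 4) ^ n / ((n.factorial : ℂ) ^ 2)) =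
      (serB (-(s / 4)) : ℂ) := by
  rw [hz, serB, seriesSum, Complex.ofReal_tsum]
  refine tsum_congr fun n => ?_
  rw [coeffHarm, neg_eq_neg_one_mul (s / 4), mul_pow]
  push_cast
  ring

/-- The regular solution of the Bessel equation `u'' + u'/t = σ u`; `σ = -1` gives `J₀` and
`σ = 1` gives `I₀`. -/
def regSol (σ t : ℝ) : ℝ := serA (σ * t ^ 2 / 4)

/-- The derivative of `regSol σ`. -/
def regSol' (σ t : ℝ) : ℝ := σ * t / 2 * serA' (σ * t ^ 2 / 4)

/-- The logarithmic solution of `u'' + u'/t = σ u`. -/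
def logSol (σ t : ℝ) : ℝ := logTerm t * regSol σ t - serB (σ * t ^ 2 / 4)

/-- The derivative of `logSol σ`. -/
def logSol' (σ t : ℝ) : ℝ :=
  regSol σ t / t + logTerm t * regSol' σ t - σ * t / 2 * serB' (σ * t ^ 2 / 4)

theorem J0_eq (t : ℝ) : J0 t = regSol (-1) t := by
  rw [J0, besselJ0_of_sq (s := t ^ 2) (by push_cast; rfl), Complex.ofReal_re, regSol]
  congr 1; ring

theorem Y0_eq {t : ℝ} (ht : 0 < t) : Y0 t = 2 / π * logSol (-1) t := by
  have hz : (t : ℂ) ^ 2 = ((t ^ 2 : ℝ) : ℂ) := by push_cast; rfl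
  have hl : Complex.log ((t : ℂ) / 2) = ((Real.log (t / 2) : ℝ) : ℂ) := by
    rw [Complex.ofReal_log (by positivity)]
    push_cast
    rfl
  have h : besselY0 t = ((2 / π * logSol (-1) t : ℝ) : ℂ) := by
    rw [besselY0, hl, besselJ0_of_sq hz, besselY0_tail_of_sq hz, logSol, regSol, logTerm,
      show (-1 : ℝ) * t ^ 2 / 4 = -(t ^ 2 / 4) by ring]
    push_cast
    ring
  rw [Y0, h, Complex.ofReal_re]

/-- The `iπ/2` in `log (it/2)` cancels the `J₀` part of the Hankel function. Here `-logSol 1` is the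
Macdonald function `K₀`. -/
theorem H0_eq {t : ℝ} (ht : 0 < t) : H0 t = -(2 / π * logSol 1 t) := by
  have hz : (Complex.I * (t : ℂ)) ^ 2 = ((-t ^ 2 : ℝ) : ℂ) := by
    rw [mul_pow, Complex.I_sq]; push_cast; ring
  have hl : Complex.log (Complex.I * (t : ℂ) / 2)
      = ((Real.log (t / 2) : ℝ) : ℂ) + ((π / 2 : ℝ) : ℂ) * Complex.I := by
    have : Complex.I * (t : ℂ) / 2 = ((t / 2 : ℝ) : ℂ) * Complex.I := by push_cast; ring
    rw [this, Complex.log_ofReal_mul (by positivity) Complex.I_ne_zero, Complex.log_I]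
    push_cast
    rfl
  have hpi : (π : ℂ) ≠ 0 := by exact_mod_cast Real.pi_ne_zero
  have h : Complex.I * hankelH10 (Complex.I * t) = ((-(2 / π * logSol 1 t) : ℝ) : ℂ) := by
    rw [hankelH10, besselY0, hl, besselJ0_of_sq hz, besselY0_tail_of_sq hz, logSol, regSol, logTerm,
      show (1 : ℝ) * t ^ 2 / 4 = -(-t ^ 2 / 4) by ring]
    push_cast
    field_simp
    ring_nf
    rw [show Complex.I ^ 3 = -Complex.I by rw [pow_succ, Complex.I_sq]; ring, Complex.I_sq]
    ring
  rw [H0, h, Complex.ofReal_re]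

theorem hasDerivAt_sq_arg (σ t : ℝ) : HasDerivAt (fun t : ℝ => σ * t ^ 2 / 4) (σ * t / 2) t := by
  convert! (((hasDerivAt_id t).pow 2).const_mul σ).div_const 4 using 1
  simp; ring

theorem hasDerivAt_regSol (σ t : ℝ) : HasDerivAt (regSol σ) (regSol' σ t) t := by
  convert! (hasDerivAt_serA _).comp t (hasDerivAt_sq_arg σ t) using 1
  rw [regSol']; ring

theorem hasDerivAt_regSol' (σ : ℝ) {t : ℝ} (ht : t ≠ 0) :
    HasDerivAt (regSol' σ) (σ * regSol σ t - regSol' σ t / t) t := by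
  convert! (((hasDerivAt_id t).const_mul σ).div_const 2).mul
    ((hasDerivAt_serA' _).comp t (hasDerivAt_sq_arg σ t)) using 1
  rw [regSol', regSol, ← serA_ode]
  simp only [id, Function.comp]
  field_simp
  ring

theorem hasDerivAt_logTerm {t : ℝ} (ht : t ≠ 0) : HasDerivAt logTerm (1 / t) t := by
  convert! (((hasDerivAt_id t).div_const 2).log (by simpa using ht)).add_const _ using 1
  simp only [id]; field_simp

theorem hasDerivAt_logSol (σ : ℝ) {t : ℝ} (ht : t ≠ 0) :
    HasDerivAt (logSol σ) (logSol' σ t) t := by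
  convert! ((hasDerivAt_logTerm ht).mul (hasDerivAt_regSol σ t)).sub
    ((hasDerivAt_serB _).comp t (hasDerivAt_sq_arg σ t)) using 1
  rw [logSol']; ring

theorem hasDerivAt_logSol' (σ : ℝ) {t : ℝ} (ht : t ≠ 0) :
    HasDerivAt (logSol' σ) (σ * logSol σ t - logSol' σ t / t) t := by
  convert! (((hasDerivAt_regSol σ t).div (hasDerivAt_id t) ht).add
    ((hasDerivAt_logTerm ht).mul (hasDerivAt_regSol' σ ht))).sub
    ((((hasDerivAt_id t).const_mul σ).div_const 2).mul
    ((hasDerivAt_serB' _).comp t (hasDerivAt_sq_arg σ t))) using 1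
  have hB := serB_ode (σ * t ^ 2 / 4)
  simp only [id, Function.comp]
  rw [logSol', logSol, regSol', ← sub_eq_zero]
  field_simp
  linear_combination (4 : ℝ) * σ * t ^ 2 * hB

/-- The logarithms cancel, and `wronskian_serA_serB` evaluates the remaining series. -/
theorem wronskian_regSol_logSol (σ : ℝ) {t : ℝ} (ht : t ≠ 0) :
    t * (regSol σ t * logSol' σ t - regSol' σ t * logSol σ t) = 1 := by
  have h := wronskian_serA_serB (σ * t ^ 2 / 4)
  rw [logSol', logSol, regSol', regSol]
  generalize hy : σ * t ^ 2 / 4 = y at h ⊢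
  field_simp
  linear_combination (-4 : ℝ) * h - 4 * (serA y * serB' y - serA' y * serB y) * hy

/-! ### Bounds on `J₀` and decay of `H₀` -/

theorem regSol_zero (σ : ℝ) : regSol σ 0 = 1 := by simp [regSol, serA_zero]

/-- The energy `J₀² + J₀'²` is nonincreasing and equals `1` at `0`. -/
theorem abs_J0_le_one {t : ℝ} (ht : 0 ≤ t) : |J0 t| ≤ 1 := by
  have hd : ∀ s : ℝ, 0 < s → HasDerivAt (fun s => regSol (-1) s ^ 2 + regSol' (-1) s ^ 2)
      (-(2 * regSol' (-1) s ^ 2 / s)) s := by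
    intro s hs
    convert! ((hasDerivAt_regSol (-1) s).pow 2).add ((hasDerivAt_regSol' (-1) hs.ne').pow 2) using 1
    field_simp
    ring
  have hcont : Continuous (fun s => regSol (-1) s ^ 2 + regSol' (-1) s ^ 2) := by
    have h1 : Continuous (regSol (-1)) :=
      continuous_iff_continuousAt.2 fun s => (hasDerivAt_regSol _ s).continuousAt
    have h2 : Continuous serA' :=
      continuous_iff_continuousAt.2 fun s => (hasDerivAt_serA' s).continuousAt
    have h3 : Continuous (regSol' (-1)) := by unfold regSol'; fun_prop
    fun_prop
  have hanti : AntitoneOn (fun s => regSol (-1) s ^ 2 + regSol' (-1) s ^ 2) (Ici 0) := by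
    refine antitoneOn_of_deriv_nonpos (convex_Ici 0) hcont.continuousOn ?_ ?_
    · intro s hs
      rw [interior_Ici] at hs
      exact (hd s hs).differentiableAt.differentiableWithinAt
    · intro s hs
      rw [interior_Ici] at hs
      have hs' : 0 < s := hs
      rw [(hd s hs).deriv]
      exact neg_nonpos.2 (by positivity)
  have h := hanti self_mem_Ici (mem_Ici.2 ht) ht
  have h0 : regSol' (-1) 0 = 0 := by simp [regSol']
  simp only [regSol_zero, h0] at h
  rw [J0_eq, ← sq_le_one_iff_abs_le_one]
  nlinarith [sq_nonneg (regSol' (-1) t)]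

/-- This is `I₁(2s) ≤ I₀(2s)`: each term on the left is a product of two consecutive `sⁿ/n!`, hence
at most the mean of their squares. -/
theorem mul_serA'_sq_le {s : ℝ} : s * serA' (s ^ 2) ≤ serA (s ^ 2) := by
  have hA := hasSum_serA (s ^ 2)
  have h0 : HasSum (fun n => coeffI (n + 1) * (s ^ 2) ^ (n + 1)) (serA (s ^ 2) - 1) := by
    have := (hasSum_nat_add_iff' 1).2 hA
    simpa [coeffI] using this
  have h1 := (hA.add h0).div_const 2
  have h2 := (hasSum_serA' (s ^ 2)).mul_left s
  have h3 := hasSum_le (fun n => ?_) h2 h1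
  · linarith
  · have hn : (0 : ℝ) < n.factorial := by exact_mod_cast n.factorial_pos
    have key := sq_nonneg (s ^ n / (n.factorial : ℝ) - s ^ (n + 1) / ((n + 1).factorial : ℝ))
    have e : s * (derivCoeff coeffI n * (s ^ 2) ^ n) =
        (s ^ n / (n.factorial : ℝ)) * (s ^ (n + 1) / ((n + 1).factorial : ℝ)) := by
      rw [derivCoeff, coeffI, Nat.factorial_succ]; push_cast; field_simp; ring
    rw [e, coeffI, coeffI]
    have e1 : 1 / (n.factorial : ℝ) ^ 2 * (s ^ 2) ^ n = (s ^ n / (n.factorial : ℝ)) ^ 2 := by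
      field_simp
      ring
    have e2 : 1 / ((n + 1).factorial : ℝ) ^ 2 * (s ^ 2) ^ (n + 1) =
        (s ^ (n + 1) / ((n + 1).factorial : ℝ)) ^ 2 := by
      field_simp
      ring
    rw [e1, e2]
    linarith

theorem harmonic_sub_log_le {s : ℝ} (hs : 0 < s) (n : ℕ) :
    (harmonic n : ℝ) - eulerMascheroniConstant - Real.log s ≤ n / s + 1 / s - 1 := by
  have h := (eulerMascheroniSeq_lt_eulerMascheroniConstant n).le
  rw [eulerMascheroniSeq] at h
  have hn : (0 : ℝ) < (n : ℝ) + 1 := by positivity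
  have h2 := Real.log_le_sub_one_of_pos (div_pos hn hs)
  rw [Real.log_div hn.ne' hs.ne', add_div] at h2
  linarith

theorem le_harmonic_sub_log {s : ℝ} (hs : 0 < s) (n : ℕ) :
    1 - (s + 1) / (n + 1) ≤ (harmonic n : ℝ) - eulerMascheroniConstant - Real.log s := by
  have h := (eulerMascheroniConstant_lt_eulerMascheroniSeq' (n + 1)).le
  rw [eulerMascheroniSeq', if_neg n.succ_ne_zero, harmonic_succ] at h
  push_cast at h
  have hn : (0 : ℝ) < (n : ℝ) + 1 := by positivity
  have h2 := Real.log_le_sub_one_of_pos (div_pos hs hn)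
  rw [Real.log_div hs.ne' hn.ne'] at h2
  rw [add_div, one_div]
  linarith

theorem hasSum_neg_logSol (t : ℝ) :
    HasSum (fun n => ((harmonic n : ℝ) - eulerMascheroniConstant - Real.log (t / 2)) *
      (coeffI n * ((t / 2) ^ 2) ^ n)) (-logSol 1 t) := by
  have h := (hasSum_serB ((t / 2) ^ 2)).sub ((hasSum_serA ((t / 2) ^ 2)).mul_left (logTerm t))
  have e : -logSol 1 t = serB ((t / 2) ^ 2) - logTerm t * serA ((t / 2) ^ 2) := by
    rw [logSol, regSol, show (1 : ℝ) * t ^ 2 / 4 = (t / 2) ^ 2 by ring]; ring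
  rw [e]
  refine h.congr_fun fun n => ?_
  rw [coeffHarm, coeffI, logTerm]
  ring

/-- With `s = t/2`, the coefficient `hₙ - γ - log s` is squeezed between simple functions of `n`
whose weighted sums are combinations of `serA` and `serA'`; `mul_serA'_sq_le` then cancels the
leading parts. The bound is crude, but it shows `K₀/I₀ → 0`, the boundary condition at infinity used
below. -/
theorem abs_logSol_one_le {t : ℝ} (ht : 0 < t) : |logSol 1 t| ≤ 2 / t * regSol 1 t := by
  have hs : 0 < t / 2 := by positivity
  have e : (2 : ℝ) / t = 1 / (t / 2) := by field_simp
  have eR : regSol 1 t = serA ((t / 2) ^ 2) := by rw [regSol]; congr 1; ring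
  have hK := hasSum_neg_logSol t
  rw [e, eR]
  generalize t / 2 = s at hs hK ⊢
  have hA := hasSum_serA (s ^ 2)
  have hA' := hasSum_serA' (s ^ 2)
  have hAM := mul_serA'_sq_le (s := s)
  have hmul := expBounded_coeffI.mul_seriesSum_derivCoeff (s ^ 2)
  change HasSum _ (s ^ 2 * serA' (s ^ 2)) at hmul
  have hpos := serA_term_nonneg (sq_nonneg s)
  have hA'le : serA' (s ^ 2) ≤ serA (s ^ 2) / s := by rw [le_div_iff₀ hs]; linarith
  have upper : -logSol 1 t ≤ 1 / s * serA (s ^ 2) := by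
    have h1 := (hmul.div_const s).add (hA.mul_left (1 / s - 1))
    have h2 := hasSum_le (fun n => ?_) hK h1
    · have e1 : s ^ 2 * serA' (s ^ 2) / s = s * serA' (s ^ 2) := by field_simp
      rw [e1] at h2
      linarith
    · have := mul_le_mul_of_nonneg_right (harmonic_sub_log_le hs n) (hpos n)
      refine this.trans (le_of_eq ?_)
      ring
  have lower : -(1 / s * serA (s ^ 2)) ≤ -logSol 1 t := by
    have h1 := hA.sub (hA'.mul_left (s + 1))
    have h2 := hasSum_le (fun n => ?_) h1 hK
    · have e1 : (s + 1) * serA' (s ^ 2) ≤ serA (s ^ 2) + serA (s ^ 2) / s := by linarith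
      have e2 : serA (s ^ 2) / s = 1 / s * serA (s ^ 2) := by ring
      linarith
    · have := mul_le_mul_of_nonneg_right (le_harmonic_sub_log hs n) (hpos n)
      refine (le_of_eq ?_).trans this
      have := sq_mul_coeffI_succ n
      rw [derivCoeff, ← this]
      field_simp
  rw [abs_le]
  constructor <;> linarith

theorem pow_four_le_regSol_one (t : ℝ) : 1 + t ^ 4 / 64 ≤ regSol 1 t := by
  have h := partialSum_le_serA (y := 1 * t ^ 2 / 4) (by positivity)
  rw [regSol]
  nlinarith [sq_nonneg t]

theorem regSol_one_pos (t : ℝ) : 0 < regSol 1 t :=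
  lt_of_lt_of_le (by positivity) (pow_four_le_regSol_one t)

theorem tendsto_logSol_div_regSol : Tendsto (fun t => -logSol 1 t / regSol 1 t) atTop (𝓝 0) := by
  have h2 : Tendsto (fun t : ℝ => 2 / t) atTop (𝓝 0) := tendsto_const_nhds.div_atTop tendsto_id
  refine squeeze_zero_norm' ?_ h2
  filter_upwards [eventually_gt_atTop 0] with t ht
  rw [Real.norm_eq_abs, abs_div, abs_neg, abs_of_pos (regSol_one_pos t),
    div_le_iff₀ (regSol_one_pos t)]
  exact abs_logSol_one_le ht

theorem hasDerivAt_logSol_div_regSol {t : ℝ} (ht : 0 < t) :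
    HasDerivAt (fun t => -logSol 1 t / regSol 1 t) (-(1 / (t * regSol 1 t ^ 2))) t := by
  have hI := (regSol_one_pos t).ne'
  convert! ((hasDerivAt_logSol 1 ht.ne').neg).div (hasDerivAt_regSol 1 t) hI using 1
  have := wronskian_regSol_logSol 1 ht.ne'
  have ht' := ht.ne'
  simp only [Pi.neg_apply]
  field_simp
  linarith

/-- A function on a half-line with nonpositive derivative and limit zero is nonnegative. -/
theorem nonneg_of_deriv_nonpos_of_tendsto_zero {g g' : ℝ → ℝ} {b : ℝ}
    (hd : ∀ t, b ≤ t → HasDerivAt g (g' t) t) (hg' : ∀ t, b ≤ t → g' t ≤ 0)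
    (hlim : Tendsto g atTop (𝓝 0)) : 0 ≤ g b := by
  have hanti : AntitoneOn g (Ici b) := by
    refine antitoneOn_of_deriv_nonpos (convex_Ici b)
      (fun t ht => (hd t ht).continuousAt.continuousWithinAt) ?_ ?_
    · intro t ht
      exact (hd t (interior_subset ht)).differentiableAt.differentiableWithinAt
    · intro t ht
      rw [(hd t (interior_subset ht)).deriv]
      exact hg' t (interior_subset ht)
  refine le_of_tendsto hlim ?_
  filter_upwards [eventually_ge_atTop b] with t ht
  exact hanti self_mem_Ici ht ht

theorem logSol_one_nonpos {t : ℝ} (ht : 0 < t) : logSol 1 t ≤ 0 := by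
  have h := nonneg_of_deriv_nonpos_of_tendsto_zero (b := t)
    (fun s hs => hasDerivAt_logSol_div_regSol (ht.trans_le hs))
    (fun s hs => by
      have := ht.trans_le hs
      exact neg_nonpos.2 (by positivity)) tendsto_logSol_div_regSol
  have := (le_div_iff₀ (regSol_one_pos t)).1 h
  linarith

/-- With `y = t²/4`, the right side is `2 ∑ n aₙ yⁿ ≥ 2 (I₀ - 1)`, and `I₀ ≥ 1 + y ≥ 2`. -/
theorem regSol_one_le_mul_regSol' {t : ℝ} (ht : 2 ≤ t) : regSol 1 t ≤ t * regSol' 1 t := by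
  have hy : (1 : ℝ) ≤ 1 * t ^ 2 / 4 := by nlinarith
  have h := partialSum_le_serA (y := 1 * t ^ 2 / 4) (by linarith)
  have hmul := expBounded_coeffI.mul_seriesSum_derivCoeff (1 * t ^ 2 / 4)
  change HasSum _ (1 * t ^ 2 / 4 * serA' (1 * t ^ 2 / 4)) at hmul
  have h1 : HasSum (fun n => coeffI (n + 1) * (1 * t ^ 2 / 4) ^ (n + 1))
      (serA (1 * t ^ 2 / 4) - 1) := by
    have := (hasSum_nat_add_iff' 1).2 (hasSum_serA (1 * t ^ 2 / 4))
    simpa [coeffI] using this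
  have h2 : HasSum (fun n : ℕ => ((n + 1 : ℕ) : ℝ) * coeffI (n + 1) * (1 * t ^ 2 / 4) ^ (n + 1))
      (1 * t ^ 2 / 4 * serA' (1 * t ^ 2 / 4)) := by
    have := (hasSum_nat_add_iff' 1).2 hmul
    simpa using this
  have h3 := hasSum_le (fun n => ?_) h1 h2
  · rw [regSol, regSol']
    nlinarith
  · have := serA_term_nonneg (y := 1 * t ^ 2 / 4) (by linarith) (n + 1)
    push_cast
    nlinarith [n.cast_nonneg (α := ℝ)]

/-- Both `1/(2 I₀²)` and `K₀/I₀` tend to `0`, and `I₀ ≤ t I₀'` makes the first decrease at least as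
fast, so it is the larger. -/
theorem neg_logSol_one_le {t : ℝ} (ht : 2 ≤ t) : -logSol 1 t ≤ 1 / (2 * regSol 1 t) := by
  have hI : Tendsto (fun t => regSol 1 t) atTop atTop := by
    refine tendsto_atTop_mono' _ ?_ tendsto_id
    filter_upwards [eventually_ge_atTop 4] with s hs
    have h64 : (4 : ℝ) ^ 3 ≤ s ^ 3 := by gcongr
    have := pow_four_le_regSol_one s
    simp only [id]
    nlinarith
  have hlim : Tendsto (fun t => 1 / 2 / regSol 1 t ^ 2 - -logSol 1 t / regSol 1 t) atTop (𝓝 0) := by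
    have h1 : Tendsto (fun t => 1 / 2 / regSol 1 t ^ 2) atTop (𝓝 0) :=
      tendsto_const_nhds.div_atTop ((tendsto_pow_atTop two_ne_zero).comp hI)
    simpa using h1.sub tendsto_logSol_div_regSol
  have h := nonneg_of_deriv_nonpos_of_tendsto_zero (b := t)
    (g' := fun s => -(regSol' 1 s / regSol 1 s ^ 3) - -(1 / (s * regSol 1 s ^ 2)))
    (fun s hs => by
      have hI0 := (regSol_one_pos s).ne'
      have hs0 : 0 < s := by linarith
      convert! ((hasDerivAt_const s (1 / 2 : ℝ)).div ((hasDerivAt_regSol 1 s).pow 2)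
        (pow_ne_zero 2 hI0)).sub (hasDerivAt_logSol_div_regSol hs0) using 1
      congr 1
      simp only [Pi.pow_apply]
      field_simp
      ring)
    (fun s hs => by
      have hI0 := regSol_one_pos s
      have hs0 : 0 < s := by linarith
      have := regSol_one_le_mul_regSol' (ht.trans hs)
      rw [sub_neg_eq_add, neg_add_nonpos_iff, div_le_div_iff₀ (by positivity) (by positivity)]
      nlinarith [pow_pos hI0 2])
    hlim
  have hI0 := regSol_one_pos t
  have e : 1 / 2 / regSol 1 t ^ 2 - -logSol 1 t / regSol 1 t =
      (1 / (2 * regSol 1 t) - -logSol 1 t) / regSol 1 t := by field_simp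
  rw [e] at h
  have := (le_div_iff₀ hI0).1 h
  linarith

/-- A bound on `H₀` that suffices in the oscillatory regime of `J₀` and `Y₀`. -/
theorem abs_H0_le {t : ℝ} (ht : 2 ≤ t) : |H0 t| ≤ 2 / π * (32 / t ^ 4) := by
  have ht0 : 0 < t := by linarith
  rw [H0_eq ht0, ← mul_neg, abs_mul, abs_of_pos (by positivity : 0 < 2 / π),
    abs_of_nonneg (by linarith [logSol_one_nonpos ht0])]
  refine mul_le_mul_of_nonneg_left ((neg_logSol_one_le ht).trans ?_) (by positivity)
  have := pow_four_le_regSol_one t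
  rw [div_le_div_iff₀ (by linarith [regSol_one_pos t]) (by positivity)]
  linarith

/-! ### The oscillatory regime -/

/-- A solution of the Bessel equation `f'' + f'/t + f = 0` that vanishes at `q` is bounded from
below in terms of `f' q` at points `p < q` at distance at most a quarter period. -/
theorem bessel_solution_lower_bound {f f' : ℝ → ℝ} {p q : ℝ} (hp : 0 < p) (hpq : p ≤ q)
    (hlen : q - p ≤ π / 2) (hf : ∀ t, p ≤ t → HasDerivAt f (f' t) t)
    (hf' : ∀ t, p ≤ t → HasDerivAt f' (-f t - f' t / t) t) (hq : f q = 0) :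
    |f' q| * (Real.sin (q - p) - q * (q - p) / p ^ 2) ≤ |f p| := by
  -- This weighted energy is nondecreasing, so `f q = 0` yields `t |f' t| ≤ q |f' q|` for `t ≤ q`.
  have hE : ∀ t, p ≤ t → HasDerivAt (fun t => t ^ 2 * (f t ^ 2 + f' t ^ 2)) (2 * t * f t ^ 2) t := by
    intro t ht
    have ht0 : t ≠ 0 := (hp.trans_le ht).ne'
    convert! ((hasDerivAt_id t).pow 2).mul (((hf t ht).pow 2).add ((hf' t ht).pow 2)) using 1
    simp only [id, Pi.pow_apply, Pi.add_apply]
    field_simp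
    ring
  have hmono : MonotoneOn (fun t => t ^ 2 * (f t ^ 2 + f' t ^ 2)) (Ici p) := by
    refine monotoneOn_of_deriv_nonneg (convex_Ici p)
      (fun t ht => (hE t ht).continuousAt.continuousWithinAt) ?_ ?_
    · intro t ht
      exact (hE t (interior_subset ht)).differentiableAt.differentiableWithinAt
    · intro t ht
      have ht' : p ≤ t := interior_subset ht
      have ht0 : 0 < t := hp.trans_le ht'
      rw [(hE t ht').deriv]
      positivity
  have hbound : ∀ t ∈ Icc p q, |f' t / t| ≤ q * |f' q| / p ^ 2 := by
    intro t ht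
    have ht0 : 0 < t := hp.trans_le ht.1
    have h := hmono (mem_Ici.2 ht.1) (mem_Ici.2 hpq) ht.2
    simp only [hq] at h
    have h1 : (t * f' t) ^ 2 ≤ (q * f' q) ^ 2 := by nlinarith [sq_nonneg (t * f t)]
    have h2 := sq_le_sq.1 h1
    rw [abs_mul, abs_mul, abs_of_pos ht0, abs_of_pos (hp.trans_le hpq)] at h2
    rw [abs_div, abs_of_pos ht0]
    calc |f' t| / t = t * |f' t| / t ^ 2 := by field_simp
      _ ≤ q * |f' q| / p ^ 2 := by
        have := ht.1
        have : 0 ≤ q := hp.le.trans hpq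
        gcongr
  -- This combination would be constant if `f'' = -f`; the damping term is the only source of drift.
  -- It equals `f p` at `p` and `-f' q sin (q - p)` at `q`.
  have hW : ∀ t ∈ Icc p q, HasDerivWithinAt
      (fun t => f t * Real.cos (t - p) - f' t * Real.sin (t - p))
      (f' t / t * Real.sin (t - p)) (Icc p q) t := by
    intro t ht
    have hs : HasDerivAt (fun t => t - p) 1 t := (hasDerivAt_id t).sub_const p
    refine HasDerivAt.hasDerivWithinAt ?_
    convert! ((hf t ht.1).mul hs.cos).sub ((hf' t ht.1).mul hs.sin) using 1
    ring
  have hdiff := (convex_Icc p q).norm_image_sub_le_of_norm_hasDerivWithin_le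
    (C := q * |f' q| / p ^ 2) hW (fun t ht => by
      rw [norm_mul, Real.norm_eq_abs, Real.norm_eq_abs]
      exact (mul_le_of_le_one_right (abs_nonneg _) (Real.abs_sin_le_one _)).trans (hbound t ht))
    (left_mem_Icc.2 hpq) (right_mem_Icc.2 hpq)
  simp only [hq, sub_self, Real.cos_zero, Real.sin_zero, Real.norm_eq_abs] at hdiff
  rw [abs_of_nonneg (sub_nonneg.2 hpq)] at hdiff
  have hsin : 0 ≤ Real.sin (q - p) :=
    Real.sin_nonneg_of_nonneg_of_le_pi (by linarith) (by linarith [Real.pi_pos])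
  have h3 : |f' q| * Real.sin (q - p) = |f' q * Real.sin (q - p)| := by
    rw [abs_mul, abs_of_nonneg hsin]
  have h4 : |f' q * Real.sin (q - p)| ≤
      |f p| + |0 * Real.cos (q - p) - f' q * Real.sin (q - p) - (f p * 1 - f' p * 0)| := by
    have := abs_sub (-(f p)) (0 * Real.cos (q - p) - f' q * Real.sin (q - p) - (f p * 1 - f' p * 0))
    rw [abs_neg] at this
    refine le_trans (le_of_eq ?_) this
    congr 1
    ring
  have h5 : |f' q| * (q * (q - p) / p ^ 2) = q * |f' q| / p ^ 2 * (q - p) := by ring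
  rw [mul_sub, h3, h5]
  linarith

/-- The cross product `J₀(q) Y₀(p) - Y₀(q) J₀(p)` at arguments about a quarter period apart. -/
theorem cross_product_lower_bound {p q : ℝ} (hp : 5 * π / 2 ≤ p) (hlen : q - p ≤ π / 2)
    (hgap : 37 / 100 * π ≤ q - p) : 1 / (π * q) ≤ |J0 q * Y0 p - Y0 q * J0 p| := by
  have hpi := Real.pi_pos
  have hp0 : 0 < p := by linarith
  have hpq : p ≤ q := by linarith
  have hq0 : 0 < q := by linarith
  have h := bessel_solution_lower_bound (p := p) (q := q)
    (f := fun t => regSol (-1) q * logSol (-1) t - logSol (-1) q * regSol (-1) t)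
    (f' := fun t => regSol (-1) q * logSol' (-1) t - logSol (-1) q * regSol' (-1) t)
    hp0 hpq hlen
    (fun t ht => ((hasDerivAt_logSol (-1) (hp0.trans_le ht).ne').const_mul _).sub
      ((hasDerivAt_regSol (-1) t).const_mul _))
    (fun t ht => by
      have ht0 := (hp0.trans_le ht).ne'
      convert! ((hasDerivAt_logSol' (-1) ht0).const_mul (regSol (-1) q)).sub
        ((hasDerivAt_regSol' (-1) ht0).const_mul (logSol (-1) q)) using 1
      ring)
    (by ring)
  have hW : regSol (-1) q * logSol' (-1) q - logSol (-1) q * regSol' (-1) q = 1 / q := by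
    have := wronskian_regSol_logSol (-1) hq0.ne'
    rw [eq_div_iff hq0.ne']
    linarith
  simp only [hW] at h
  rw [abs_of_pos (by positivity : 0 < 1 / q)] at h
  -- Jordan's inequality. Subtracting the drift bound `6/25` below leaves exactly `1/2`.
  have hsin : 37 / 50 ≤ Real.sin (q - p) := by
    refine le_trans ?_ (Real.mul_le_sin (by linarith) hlen)
    calc (37 / 50 : ℝ) = 2 / π * (37 / 100 * π) := by field_simp; norm_num
      _ ≤ 2 / π * (q - p) := by gcongr
  have herr : q * (q - p) / p ^ 2 ≤ 6 / 25 := by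
    rw [div_le_iff₀ (by positivity)]
    have h1 : q ≤ 6 / 5 * p := by linarith
    have h2 : q - p ≤ 1 / 5 * p := by linarith
    nlinarith
  have e : J0 q * Y0 p - Y0 q * J0 p =
      2 / π * (regSol (-1) q * logSol (-1) p - logSol (-1) q * regSol (-1) p) := by
    rw [J0_eq, J0_eq, Y0_eq hp0, Y0_eq hq0]; ring
  rw [e, abs_mul, abs_of_pos (by positivity : 0 < 2 / π)]
  calc 1 / (π * q) = 2 / π * (1 / q * (1 / 2)) := by field_simp
    _ ≤ 2 / π * (1 / q * (Real.sin (q - p) - q * (q - p) / p ^ 2)) := by gcongr; linarith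
    _ ≤ _ := by gcongr

theorem abs_H0_mul_J0_sub_le {p q : ℝ} (hp : 5 * π / 2 ≤ p) (hpq : p ≤ q)
    (hlen : q - p ≤ π / 2) : |H0 q * J0 p - H0 p * J0 q| ≤ 1 / (2 * (π * q)) := by
  have hpi := Real.pi_gt_d2
  have hp7 : 157 / 20 ≤ p := by linarith
  have hp0 : 0 < p := by linarith
  have hq0 : 0 < q := by linarith
  have h1 : |H0 q * J0 p| ≤ 2 / π * (32 / p ^ 4) := by
    rw [abs_mul]
    calc |H0 q| * |J0 p| ≤ |H0 q| * 1 := by gcongr; exact abs_J0_le_one hp0.le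
      _ ≤ 2 / π * (32 / q ^ 4) := by rw [mul_one]; exact abs_H0_le (by linarith)
      _ ≤ _ := by gcongr
  have h2 : |H0 p * J0 q| ≤ 2 / π * (32 / p ^ 4) := by
    rw [abs_mul]
    calc |H0 p| * |J0 q| ≤ |H0 p| * 1 := by gcongr; exact abs_J0_le_one hq0.le
      _ ≤ _ := by rw [mul_one]; exact abs_H0_le (by linarith)
  have h3 := abs_sub (H0 q * J0 p) (H0 p * J0 q)
  have h4 : 2 / π * (64 / p ^ 4) ≤ 1 / (2 * (π * q)) := by
    have hp3 : (157 / 20 : ℝ) ^ 3 ≤ p ^ 3 := by gcongr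
    have hq1 : q ≤ 6 / 5 * p := by linarith
    -- Here `256 · 6/5 < 308`, while `p³ ≥ 7.85³ > 483`.
    have : 256 * q ≤ p ^ 4 := by nlinarith
    rw [div_mul_div_comm, div_le_div_iff₀ (by positivity) (by positivity)]
    nlinarith
  have h5 : 2 / π * (64 / p ^ 4) = 2 / π * (32 / p ^ 4) + 2 / π * (32 / p ^ 4) := by ring
  linarith

/-- Both determinants, up to powers of the wave number, in the oscillatory regime. -/
theorem oscillatory_lower_bound {p q σ : ℝ} (hσ : |σ| = 1) (hp : 5 * π / 2 ≤ p)
    (hlen : q - p ≤ π / 2) (hgap : 37 / 100 * π ≤ q - p) :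
    1 / (2 * (π * q)) ≤ |(H0 q + σ * Y0 q) * J0 p - (H0 p + σ * Y0 p) * J0 q| := by
  have hpi := Real.pi_pos
  have h1 := cross_product_lower_bound hp hlen hgap
  have h2 := abs_H0_mul_J0_sub_le hp (by linarith) hlen
  have h3 : |σ * (J0 q * Y0 p - Y0 q * J0 p)| = |J0 q * Y0 p - Y0 q * J0 p| := by
    rw [abs_mul, hσ, one_mul]
  have h4 := abs_sub_abs_le_abs_sub (σ * (J0 q * Y0 p - Y0 q * J0 p)) (H0 q * J0 p - H0 p * J0 q)
  have h5 : |(H0 q + σ * Y0 q) * J0 p - (H0 p + σ * Y0 p) * J0 q| =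
      |σ * (J0 q * Y0 p - Y0 q * J0 p) - (H0 q * J0 p - H0 p * J0 q)| := by
    rw [← abs_neg]; congr 1; ring
  have h6 : 1 / (π * q) = 1 / (2 * (π * q)) + 1 / (2 * (π * q)) := by
    rw [← add_div, one_add_one_eq_two, div_mul_cancel_left₀ two_ne_zero, one_div]
  rw [h5]
  linarith

/-! ### Numerical bounds at the wave number `k₀` -/

theorem abs_serA_sub_le {y : ℝ} (hy : |y| ≤ 1) :
    |serA y - (1 + y + y ^ 2 / 4)| ≤ 11 / 50 * |y| ^ 3 := by
  have h := expBounded_coeffI.abs_seriesSum_sub_le hy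
  convert h using 2
  norm_num [serA, coeffI]
  ring

theorem abs_serB_sub_le {y : ℝ} (hy : |y| ≤ 1) :
    |serB y - (y + 3 / 8 * y ^ 2)| ≤ 11 / 50 * |y| ^ 3 := by
  have h := expBounded_coeffHarm.abs_seriesSum_sub_le hy
  convert h using 2
  norm_num [serB, coeffHarm, harmonic, Finset.sum_range_succ]

theorem H0_add_Y0_eq {t : ℝ} (ht : 0 < t) :
    H0 t + Y0 t = 2 / π * (serB (t ^ 2 / 4) - serB (-(t ^ 2 / 4)) -
      logTerm t * (serA (t ^ 2 / 4) - serA (-(t ^ 2 / 4)))) := by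
  rw [H0_eq ht, Y0_eq ht, logSol, logSol, regSol, regSol,
    show (1 : ℝ) * t ^ 2 / 4 = t ^ 2 / 4 by ring, show (-1 : ℝ) * t ^ 2 / 4 = -(t ^ 2 / 4) by ring]
  ring

theorem H0_sub_Y0_eq {t : ℝ} (ht : 0 < t) :
    H0 t - Y0 t = 2 / π * (serB (t ^ 2 / 4) + serB (-(t ^ 2 / 4)) -
      logTerm t * (serA (t ^ 2 / 4) + serA (-(t ^ 2 / 4)))) := by
  rw [H0_eq ht, Y0_eq ht, logSol, logSol, regSol, regSol,
    show (1 : ℝ) * t ^ 2 / 4 = t ^ 2 / 4 by ring, show (-1 : ℝ) * t ^ 2 / 4 = -(t ^ 2 / 4) by ring]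
  ring

/-- The estimates `log x ≤ x - 1` and `γ < 2/3` are precise enough. -/
theorem logTerm_le {t b : ℝ} (ht : 0 < t) (hb : t / 2 ≤ b) : logTerm t ≤ b - 1 / 3 := by
  have h := Real.log_le_sub_one_of_pos (half_pos ht)
  have := Real.eulerMascheroniConstant_lt_two_thirds
  rw [logTerm]
  linarith

theorem le_logTerm {t b : ℝ} (hb : 0 < b) (ht : b ≤ t / 2) : 3 / 2 - 1 / b ≤ logTerm t := by
  have h := Real.one_sub_inv_le_log_of_pos (hb.trans_le ht)
  have h2 : (t / 2)⁻¹ ≤ b⁻¹ := inv_anti₀ hb ht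
  have := Real.one_half_lt_eulerMascheroniConstant
  rw [logTerm, one_div]
  linarith

theorem serA_serB_bounds {x b : ℝ} (hx : 0 ≤ x) (hxb : x ≤ b) (hb : b ≤ 1) :
    (|serA x - (1 + x + x ^ 2 / 4)| ≤ 11 / 50 * b ^ 3 ∧
      |serA (-x) - (1 - x + x ^ 2 / 4)| ≤ 11 / 50 * b ^ 3) ∧
    |serB x - (x + 3 / 8 * x ^ 2)| ≤ 11 / 50 * b ^ 3 ∧
      |serB (-x) - (-x + 3 / 8 * x ^ 2)| ≤ 11 / 50 * b ^ 3 := by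
  have habs : |x| = x := abs_of_nonneg hx
  have hpos : |x| ≤ 1 := by linarith
  have hneg : |-x| ≤ 1 := by rwa [abs_neg]
  have hcube : 11 / 50 * x ^ 3 ≤ 11 / 50 * b ^ 3 := by gcongr
  have hA := abs_serA_sub_le hpos
  have hA' := abs_serA_sub_le hneg
  have hB := abs_serB_sub_le hpos
  have hB' := abs_serB_sub_le hneg
  rw [abs_neg] at hA' hB'
  rw [habs] at hA hA' hB hB'
  rw [neg_sq, ← sub_eq_add_neg] at hA'
  rw [neg_sq] at hB'
  exact ⟨⟨hA.trans hcube, hA'.trans hcube⟩, hB.trans hcube, hB'.trans hcube⟩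

theorem J0_eq_serA (t : ℝ) : J0 t = serA (-(t ^ 2 / 4)) := by
  rw [J0_eq, regSol]; congr 1; ring

/-- The values needed at the smaller of the two arguments at the wave number `k₀`. -/
theorem small_argument_bounds {q : ℝ} (hq : 157 / 500 ≤ q) (hq' : q ≤ 43 / 125) :
    97 / 100 ≤ J0 q ∧ H0 q + Y0 q ≤ 2 / π * (7 / 20) ∧ 2 / π * (3 / 10) ≤ H0 q - Y0 q := by
  have hq0 : 0 < q := by linarith
  have hpi := Real.pi_pos
  have hl1 := logTerm_le (b := 43 / 250) hq0 (by linarith)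
  have hl2 := le_logTerm (t := q) (b := 157 / 1000) (by norm_num) (by linarith)
  have hx0 : 0 ≤ q ^ 2 / 4 := by positivity
  have hx2 : q ^ 2 / 4 ≤ 296 / 10000 := by nlinarith
  rw [J0_eq_serA, H0_add_Y0_eq hq0, H0_sub_Y0_eq hq0]
  generalize q ^ 2 / 4 = x at hx0 hx2 ⊢
  generalize logTerm q = l at hl1 hl2 ⊢
  obtain ⟨⟨hA, hA'⟩, hB, hB'⟩ := serA_serB_bounds hx0 hx2 (by norm_num)
  rw [abs_le] at hA hA' hB hB'
  norm_num at hA hA' hB hB' hl1 hl2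
  have hxx : 0 ≤ x ^ 2 := sq_nonneg x
  have hxx' : x ^ 2 ≤ 1 / 1000 := by nlinarith
  refine ⟨by linarith, ?_, ?_⟩
  · refine mul_le_mul_of_nonneg_left ?_ (by positivity)
    have h1 : -l * (serA x - serA (-x)) ≤ 765 / 157 * (593 / 10000) := by
      have : serA x - serA (-x) ≤ 593 / 10000 := by linarith
      have hl0 : 0 ≤ -l := by linarith
      calc -l * (serA x - serA (-x)) ≤ -l * (593 / 10000) := by gcongr
        _ ≤ _ := by gcongr; linarith
    linarith
  · refine mul_le_mul_of_nonneg_left ?_ (by positivity)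
    have h1 : 4 / 25 * (199 / 100) ≤ -l * (serA x + serA (-x)) := by
      have : 199 / 100 ≤ serA x + serA (-x) := by linarith
      have hl0 : 4 / 25 ≤ -l := by linarith
      gcongr
    linarith

/-- The values needed at the larger of the two arguments at the wave number `k₀`. -/
theorem large_argument_bounds {p : ℝ} (hp : 31 / 20 ≤ p) (hp' : p ≤ 1571 / 1000) :
    2 / 5 ≤ J0 p ∧ 2 / π * (12 / 25) ≤ H0 p + Y0 p ∧ H0 p - Y0 p ≤ 0 := by
  have hp0 : 0 < p := by linarith
  have hpi := Real.pi_pos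
  have hl1 := logTerm_le (b := 1571 / 2000) hp0 (by linarith)
  have hl2 := le_logTerm (t := p) (b := 31 / 40) (by norm_num) (by linarith)
  have hx1 : 3 / 5 ≤ p ^ 2 / 4 := by nlinarith
  have hx2 : p ^ 2 / 4 ≤ 6171 / 10000 := by nlinarith
  rw [J0_eq_serA, H0_add_Y0_eq hp0, H0_sub_Y0_eq hp0]
  generalize p ^ 2 / 4 = x at hx1 hx2 ⊢
  generalize logTerm p = l at hl1 hl2 ⊢
  obtain ⟨⟨hA, hA'⟩, hB, hB'⟩ := serA_serB_bounds (by linarith) hx2 (by norm_num)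
  rw [abs_le] at hA hA' hB hB'
  norm_num at hA hA' hB hB' hl1 hl2
  have hxx : 9 / 25 ≤ x ^ 2 := by nlinarith
  have hxx' : x ^ 2 ≤ 381 / 1000 := by nlinarith
  refine ⟨by linarith, ?_, ?_⟩
  · refine mul_le_mul_of_nonneg_left ?_ (by positivity)
    have h1 : l * (serA x - serA (-x)) ≤ 453 / 1000 * (134 / 100) := by
      have : serA x - serA (-x) ≤ 134 / 100 := by linarith
      have hl0 : 0 ≤ l := by linarith
      calc l * (serA x - serA (-x)) ≤ l * (134 / 100) := by gcongr
        _ ≤ _ := by gcongr; linarith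
    linarith
  · refine mul_nonpos_of_nonneg_of_nonpos (by positivity) ?_
    have h1 : 209 / 1000 * (207 / 100) ≤ l * (serA x + serA (-x)) := by
      have : 207 / 100 ≤ serA x + serA (-x) := by linarith
      have hl0 : 209 / 1000 ≤ l := by linarith
      gcongr
    linarith

/-- Both determinants, up to powers of the wave number, at the wave number `k₀`. -/
theorem low_frequency_lower_bound {p q σ : ℝ} (hσ : |σ| = 1) (hp : 31 / 20 ≤ p)
    (hp' : p ≤ 1571 / 1000) (hq : 157 / 500 ≤ q) (hq' : q ≤ 43 / 125) :
    1 / 20 ≤ |(H0 q + σ * Y0 q) * J0 p - (H0 p + σ * Y0 p) * J0 q| := by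
  obtain ⟨hJq, hqadd, hqsub⟩ := small_argument_bounds hq hq'
  obtain ⟨hJp, hpadd, hpsub⟩ := large_argument_bounds hp hp'
  have hJp1 := (abs_le.1 (abs_J0_le_one (t := p) (by linarith))).2
  have hpi : 1 / 2 ≤ 2 / π := by
    rw [div_le_div_iff₀ two_pos Real.pi_pos]; linarith [Real.pi_lt_four]
  generalize 2 / π = w at hpi hqadd hqsub hpadd
  -- For `σ = 1` the `p` term dominates; for `σ = -1` the two terms reinforce each other. The
  -- margins are `0.1156 w` and `0.12 w`, with `w ≥ 1/2`.
  rcases eq_or_eq_neg_of_abs_eq hσ with rfl | rfl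
  · rw [one_mul, one_mul]
    refine le_trans ?_ (neg_le_abs _)
    have h1 : w * (12 / 25) * (97 / 100) ≤ (H0 p + Y0 p) * J0 q :=
      mul_le_mul hpadd hJq (by norm_num) (le_trans (by linarith) hpadd)
    have h2 : (H0 q + Y0 q) * J0 p ≤ w * (7 / 20) := by
      calc (H0 q + Y0 q) * J0 p ≤ w * (7 / 20) * J0 p := by gcongr
        _ ≤ w * (7 / 20) := mul_le_of_le_one_right (by linarith) hJp1
    linarith
  · rw [neg_one_mul, neg_one_mul, ← sub_eq_add_neg, ← sub_eq_add_neg]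
    refine le_trans ?_ (le_abs_self _)
    have h1 : w * (3 / 10) * (2 / 5) ≤ (H0 q - Y0 q) * J0 p :=
      mul_le_mul hqsub hJp (by norm_num) (le_trans (by linarith) hqsub)
    have h2 : (H0 p - Y0 p) * J0 q ≤ 0 :=
      mul_nonpos_of_nonpos_of_nonneg hpsub (by linarith)
    linarith

/-! ### Distances from the arc to the sources -/

theorem dist_polar_sq (R μ ϑ φ : ℝ) :
    dist (polar R ϑ) (polar (μ * R) φ) ^ 2 = R ^ 2 * (1 + μ ^ 2 - 2 * μ * Real.cos (ϑ - φ)) := by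
  rw [EuclideanSpace.dist_eq, Real.sq_sqrt (by positivity), Fin.sum_univ_two, Real.dist_eq,
    Real.dist_eq, sq_abs, sq_abs, Real.cos_sub]
  simp only [polar, PiLp.toLp_apply, Matrix.cons_val_zero, Matrix.cons_val_one]
  linear_combination R ^ 2 * Real.sin_sq_add_cos_sq ϑ + μ ^ 2 * R ^ 2 * Real.sin_sq_add_cos_sq φ

/-- A point on the arc seen from a source: the distance in units of the radius. -/
theorem exists_arc_angle {R : ℝ} (hR : 0 ≤ R) {m j : ℕ} (hm : 10 ≤ m)
    {x : EuclideanSpace ℝ (Fin 2)} (hx : x ∈ arc R m j) :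
    ∃ c : ℝ, 9506 / 10000 ≤ c ∧ c ≤ 1 ∧ ∀ μ : ℝ, ∃ ρ : ℝ, 0 ≤ ρ ∧
      ρ ^ 2 = 1 + μ ^ 2 - 2 * μ * c ∧
      dist x (polar (μ * R) (theta m (2 * j - 1))) = R * ρ := by
  obtain ⟨ϑ, ⟨h1, h2⟩, rfl⟩ := hx
  have hm' : (10 : ℝ) ≤ m := by exact_mod_cast hm
  have hpi := Real.pi_pos
  have hpi' := Real.pi_lt_d4
  have hstep : ∀ i : ℝ, theta m (i + 1) = theta m i + π / m := by
    intro i; rw [theta, theta]; ring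
  have e1 := hstep (2 * j - 2)
  have e2 := hstep (2 * j - 1)
  rw [show (2 * (j : ℝ) - 2 + 1) = 2 * j - 1 by ring] at e1
  rw [show (2 * (j : ℝ) - 1 + 1) = 2 * j by ring] at e2
  have hpm : π / m ≤ 31416 / 100000 := by
    rw [div_le_iff₀ (by linarith)]; linarith
  generalize theta m (2 * j - 1) = φ at e1 e2 ⊢
  refine ⟨Real.cos (ϑ - φ), ?_, Real.cos_le_one _, fun μ => ?_⟩
  -- The angle to the midpoint of the arc is at most `π/m ≤ π/10`.
  · have hsq : (ϑ - φ) ^ 2 ≤ (31416 / 100000) ^ 2 :=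
      sq_le_sq' (by linarith) (by linarith)
    have := Real.one_sub_sq_div_two_le_cos (x := ϑ - φ)
    linarith
  · have hnn : 0 ≤ 1 + μ ^ 2 - 2 * μ * Real.cos (ϑ - φ) := by
      have := Real.cos_sq_add_sin_sq (ϑ - φ)
      nlinarith [sq_nonneg (μ - Real.cos (ϑ - φ)), sq_nonneg (Real.sin (ϑ - φ))]
    refine ⟨√(1 + μ ^ 2 - 2 * μ * Real.cos (ϑ - φ)), Real.sqrt_nonneg _, Real.sq_sqrt hnn, ?_⟩
    rw [← Real.sqrt_sq (dist_nonneg (x := polar R ϑ)), dist_polar_sq,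
      Real.sqrt_mul (sq_nonneg R), Real.sqrt_sq hR]

/-- The difference of the distances to two sources that are `ε` apart on the axis. -/
theorem distance_gap {c ε ρ₁ ρ₂ : ℝ} (hc : 95 / 100 ≤ c) (hc1 : c ≤ 1) (hε : 0 < ε)
    (hε' : ε ≤ 1 / 12) (h1 : 0 ≤ ρ₁) (h2 : 0 ≤ ρ₂)
    (e1 : ρ₁ ^ 2 = 1 + (1 / 2) ^ 2 - 2 * (1 / 2) * c)
    (e2 : ρ₂ ^ 2 = 1 + (1 / 2 + ε) ^ 2 - 2 * (1 / 2 + ε) * c) :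
    1 / 2 ≤ ρ₁ ∧ ρ₁ ≤ 1 ∧ ρ₁ - ρ₂ ≤ ε ∧ 37 / 50 * ε ≤ ρ₁ - ρ₂ := by
  have hlow : 1 / 2 ≤ ρ₁ := by nlinarith
  have hup : ρ₁ ≤ 5478 / 10000 := by nlinarith
  have hprod : (ρ₁ - ρ₂) * (ρ₁ + ρ₂) = ε * (2 * c - 1 - ε) := by linear_combination e1 - e2
  have hle : ρ₂ ≤ ρ₁ := by
    have : 0 ≤ ε * (2 * c - 1 - ε) := mul_nonneg hε.le (by linarith)
    nlinarith
  -- Projection onto the axis; this is what the triangle inequality `ρ₁ ≤ ρ₂ + ε` needs.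
  have hρ₂ : c - (1 / 2 + ε) ≤ ρ₂ := by
    refine abs_le_of_sq_le_sq' ?_ h2 |>.2
    nlinarith
  refine ⟨hlow, by linarith, ?_, ?_⟩
  · refine sub_le_iff_le_add'.2 (abs_le_of_sq_le_sq' ?_ (by linarith) |>.2)
    nlinarith
  -- Otherwise the product in `hprod` is at most `0.811 ε`, whereas `2c - 1 - ε ≥ 0.816`.
  · by_contra hcon
    push Not at hcon
    have h3 : (ρ₁ - ρ₂) * (ρ₁ + ρ₂) ≤ 37 / 50 * ε * (10956 / 10000) :=
      mul_le_mul hcon.le (by linarith) (by linarith) (by positivity)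
    nlinarith

/-! ### Determinants and assembly -/

/-- The combination `(H₀ + σ Y₀)(q) J₀(p) - (H₀ + σ Y₀)(p) J₀(q)`, which gives the determinants of
the coefficient matrices. -/
def detCore (σ q p : ℝ) : ℝ := (H0 q + σ * Y0 q) * J0 p - (H0 p + σ * Y0 p) * J0 q

/-- The identity has `σ = 1` and a prefactor `-k⁻⁴`, the Laplacian `σ = -1` and no prefactor; this
explains the exponents `5` and `1`. -/
theorem le_abs_det_coeffMatrix {op : Op} {a τ k C : ℝ} {m j : ℕ} {x : EuclideanSpace ℝ (Fin 2)}
    (hk : 0 < k) (h : ∀ σ : ℝ, |σ| = 1 → C / k ≤ |detCore σ (k * dist x (source a τ k m j 0))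
      (k * dist x (source a τ k m j 1))|) :
    C * k ^ (-(op.exponent : ℤ)) ≤ |(coeffMatrix op a τ k m j x).det| := by
  rw [Matrix.det_fin_two]
  simp only [coeffMatrix, Matrix.of_apply, Matrix.cons_val_zero, Matrix.cons_val_one]
  cases op with
  | ident =>
    have h1 := h 1 (by norm_num)
    simp only [coeffA, coeffB, Op.exponent]
    generalize k * dist x (source a τ k m j 0) = q at h1 ⊢
    generalize k * dist x (source a τ k m j 1) = p at h1 ⊢
    have e : 1 / k ^ 2 * (Y0 q + H0 q) * (-(1 / k ^ 2) * J0 p) -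
        -(1 / k ^ 2) * J0 q * (1 / k ^ 2 * (Y0 p + H0 p)) = -(1 / k ^ 4 * detCore 1 q p) := by
      rw [detCore]; field_simp; ring
    rw [e, abs_neg, abs_mul, abs_of_pos (by positivity : 0 < 1 / k ^ 4)]
    refine le_trans (le_of_eq ?_) (mul_le_mul_of_nonneg_left h1 (by positivity))
    rw [zpow_neg, zpow_natCast]
    field_simp
  | laplacian =>
    have h1 := h (-1) (by norm_num)
    simp only [coeffA, coeffB, Op.exponent]
    generalize k * dist x (source a τ k m j 0) = q at h1 ⊢
    generalize k * dist x (source a τ k m j 1) = p at h1 ⊢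
    have e : (H0 q - Y0 q) * J0 p - J0 q * (H0 p - Y0 p) = detCore (-1) q p := by
      rw [detCore]; ring
    rw [e]
    refine le_trans (le_of_eq ?_) h1
    rw [zpow_neg, zpow_natCast]
    field_simp

theorem existsUnique_of_det_ne_zero {D : Matrix (Fin 2) (Fin 2) ℝ} (hD : D.det ≠ 0)
    (f : Fin 2 → ℝ) : ∃! w : Fin 2 → ℝ, ∀ i, D i 0 * w 0 + D i 1 * w 1 = f i := by
  have hu : IsUnit D.det := hD.isUnit
  have hiff : ∀ w : Fin 2 → ℝ, (∀ i, D i 0 * w 0 + D i 1 * w 1 = f i) ↔ D.mulVec w = f := by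
    intro w
    rw [funext_iff]
    simp only [Matrix.mulVec, dotProduct, Fin.sum_univ_two]
  simp only [hiff]
  refine ⟨D⁻¹.mulVec f, ?_, fun w hw => ?_⟩
  · simp only [Matrix.mulVec_mulVec, Matrix.mul_nonsing_inv _ hu, Matrix.one_mulVec]
  · rw [← hw, Matrix.mulVec_mulVec, Matrix.nonsing_inv_mul _ hu, Matrix.one_mulVec]

theorem detCore_lower_bound_high {a τ k : ℝ} (ha : 0 < a) (hτ : 6 ≤ τ) (hk : π / a ≤ k) {m j : ℕ}
    (hm : 10 ≤ m) {x : EuclideanSpace ℝ (Fin 2)} (hx : x ∈ arc (radius a τ k) m j) {σ : ℝ}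
    (hσ : |σ| = 1) :
    1 / (2 * (π * (τ * a))) / k ≤ |detCore σ (k * dist x (source a τ k m j 0))
      (k * dist x (source a τ k m j 1))| := by
  have hpi := Real.pi_pos
  have hk0 : 0 < k := lt_of_lt_of_le (by positivity) hk
  have hne : k ≠ k0 a := by
    have : k0 a < π / a := by
      rw [k0]
      gcongr
      linarith
    linarith
  have hrad : radius a τ k = τ * a := by rw [radius, if_neg hne]
  have hR : 0 < τ * a := by positivity
  rw [hrad] at hx
  obtain ⟨c, hc, hc1, hdist⟩ := exists_arc_angle hR.le hm hx
  have hkR : 6 * π ≤ k * (τ * a) := by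
    have : π ≤ k * a := by rwa [div_le_iff₀ ha] at hk
    nlinarith
  obtain ⟨ε, hεdef⟩ : ∃ ε, ε = π / (2 * k * (τ * a)) := ⟨_, rfl⟩
  have hε : 0 < ε := by rw [hεdef]; positivity
  have hkRε : k * (τ * a) * ε = π / 2 := by rw [hεdef]; field_simp
  have hε' : ε ≤ 1 / 12 := by
    rw [hεdef, div_le_div_iff₀ (by positivity) (by norm_num)]; linarith
  obtain ⟨ρ₁, h1, e1, d1⟩ := hdist (1 / 2)
  obtain ⟨ρ₂, h2, e2, d2⟩ := hdist (1 / 2 + ε)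
  have hs0 : source a τ k m j 0 = polar (1 / 2 * (τ * a)) (theta m (2 * j - 1)) := by
    simp [source, lam, hrad]
  have hs1 : source a τ k m j 1 = polar ((1 / 2 + ε) * (τ * a)) (theta m (2 * j - 1)) := by
    simp [source, lam, hrad, hne, hεdef]
  rw [hs0, hs1, d1, d2]
  obtain ⟨g1, g2, g3, g4⟩ := distance_gap (by linarith) hc1 hε hε' h1 h2 e1 e2
  have hlen : k * (τ * a * ρ₁) - k * (τ * a * ρ₂) ≤ π / 2 := by
    rw [← hkRε]; nlinarith
  have hgap : 37 / 100 * π ≤ k * (τ * a * ρ₁) - k * (τ * a * ρ₂) := by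
    have : 37 / 50 * (k * (τ * a) * ε) ≤ k * (τ * a) * (ρ₁ - ρ₂) := by nlinarith
    linarith
  -- From `k R ≥ 6π` and `ρ₁ ≥ 1/2`; with `hlen` this gives `p ≥ 5π/2`.
  have hq : 3 * π ≤ k * (τ * a * ρ₁) := by nlinarith
  refine le_trans ?_ (oscillatory_lower_bound hσ (by linarith) hlen hgap)
  rw [div_div]
  gcongr 1 / ?_
  have : k * (τ * a * ρ₁) ≤ k * (τ * a) := by
    have : 0 < k * (τ * a) := by positivity
    nlinarith
  nlinarith

theorem detCore_lower_bound_low {a τ : ℝ} (ha : 0 < a) {m j : ℕ}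
    (hm : 10 ≤ m) {x : EuclideanSpace ℝ (Fin 2)} (hx : x ∈ arc (radius a τ (k0 a)) m j) {σ : ℝ}
    (hσ : |σ| = 1) :
    1 / 20 ≤ |detCore σ (k0 a * dist x (source a τ (k0 a) m j 0))
      (k0 a * dist x (source a τ (k0 a) m j 1))| := by
  have hpi := Real.pi_gt_d4
  have hpi' := Real.pi_lt_d4
  have hrad : radius a τ (k0 a) = 6 * a := by rw [radius, if_pos rfl]
  rw [hrad] at hx
  obtain ⟨c, hc, hc1, hdist⟩ := exists_arc_angle (by positivity) hm hx
  obtain ⟨ρ₁, h1, e1, d1⟩ := hdist (1 / 2)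
  obtain ⟨ρ₂, h2, e2, d2⟩ := hdist (-3 / 2)
  have hs0 : source a τ (k0 a) m j 0 = polar (1 / 2 * (6 * a)) (theta m (2 * j - 1)) := by
    simp [source, lam, hrad]
  have hs1 : source a τ (k0 a) m j 1 = polar (-3 / 2 * (6 * a)) (theta m (2 * j - 1)) := by
    simp [source, lam, hrad]
  have hscale : ∀ ρ : ℝ, k0 a * (6 * a * ρ) = π / 5 * ρ := by
    intro ρ; rw [k0]; field_simp; ring
  rw [hs0, hs1, d1, d2, hscale, hscale]
  -- Here `ρ₁² = 5/4 - c` and `ρ₂² = 13/4 + 3c` with `0.9506 ≤ c ≤ 1`; multiplying by `k₀ R = π/5`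
  -- gives the intervals of `low_frequency_lower_bound`.
  have a1 : 1 / 2 ≤ ρ₁ := by nlinarith
  have a2 : ρ₁ ≤ 5472 / 10000 := by nlinarith
  have a3 : 247 / 100 ≤ ρ₂ := by nlinarith
  have a4 : ρ₂ ≤ 5 / 2 := by nlinarith
  apply low_frequency_lower_bound hσ <;> nlinarith

theorem pi_div_le_of_lattice {a : ℝ} (ha : 0 < a) {l₁ l₂ : ℤ} (hl : 1 ≤ max |l₁| |l₂|) :
    π / a ≤ π / a * √((l₁ : ℝ) ^ 2 + (l₂ : ℝ) ^ 2) := by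
  have hpi := Real.pi_pos
  refine le_mul_of_one_le_right (by positivity) (Real.one_le_sqrt.2 ?_)
  have h : (1 : ℤ) ≤ l₁ ^ 2 + l₂ ^ 2 := by
    rcases le_max_iff.1 hl with h | h
    · nlinarith [sq_abs l₁, sq_nonneg l₂]
    · nlinarith [sq_abs l₂, sq_nonneg l₁]
  exact_mod_cast h

end PhaseRetrieval

end

/-- The constant `C` depends only on `a` and `τ`. The second conjunct is the unique solvability of
the phase-retrieval system `A_ℓ ξ + B_ℓ η = f_ℓ`, `ℓ = 1, 2`, for every real right-hand side. -/
theorem mainTheorem2 (a τ : ℝ) (ha : 0 < a) (hτ : 6 ≤ τ) :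
    ∃ C : ℝ, 0 < C ∧
      ∀ (op : PhaseRetrieval.Op) (m N : ℕ), 10 ≤ m → 1 ≤ N →
        ∀ k ∈ PhaseRetrieval.admissible a N,
        ∀ j : ℕ, 1 ≤ j → j ≤ m →
        ∀ x ∈ PhaseRetrieval.arc (PhaseRetrieval.radius a τ k) m j,
          C * k ^ (-(op.exponent : ℤ)) ≤ |(PhaseRetrieval.coeffMatrix op a τ k m j x).det| ∧
          ∀ f : Fin 2 → ℝ, ∃! w : Fin 2 → ℝ,
            ∀ ℓ : Fin 2,
              PhaseRetrieval.coeffA op k (dist x (PhaseRetrieval.source a τ k m j ℓ)) * w 0 +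
                PhaseRetrieval.coeffB op k (dist x (PhaseRetrieval.source a τ k m j ℓ)) * w 1 =
                f ℓ := by
  have hpi := Real.pi_pos
  have hk0 : 0 < PhaseRetrieval.k0 a := by rw [PhaseRetrieval.k0]; positivity
  -- The second entry rewrites the bound `1/20` at `k₀` as `(k₀/20) / k₀`.
  obtain ⟨C, hC⟩ : ∃ C, C = min (1 / (2 * (Real.pi * (τ * a)))) (PhaseRetrieval.k0 a / 20) :=
    ⟨_, rfl⟩
  have hC0 : 0 < C := by rw [hC]; exact lt_min (by positivity) (by positivity)
  refine ⟨C, hC0, fun op m N hm _ k hk j _ _ x hx => ?_⟩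
  obtain ⟨hkpos, hcore⟩ : 0 < k ∧ ∀ σ : ℝ, |σ| = 1 →
      C / k ≤ |PhaseRetrieval.detCore σ (k * dist x (PhaseRetrieval.source a τ k m j 0))
        (k * dist x (PhaseRetrieval.source a τ k m j 1))| := by
    rcases hk with ⟨l₁, l₂, hl, -, hkl⟩ | rfl
    · have hk1 : Real.pi / a ≤ k := hkl ▸ PhaseRetrieval.pi_div_le_of_lattice ha hl
      have hkpos : 0 < k := lt_of_lt_of_le (by positivity) hk1
      refine ⟨hkpos, fun σ hσ => ?_⟩
      refine le_trans ?_ (PhaseRetrieval.detCore_lower_bound_high ha hτ hk1 hm hx hσ)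
      rw [hC]
      gcongr
      exact min_le_left _ _
    · refine ⟨hk0, fun σ hσ => ?_⟩
      refine le_trans ?_ (PhaseRetrieval.detCore_lower_bound_low ha hm hx hσ)
      rw [div_le_iff₀ hk0, hC]
      exact (min_le_right _ _).trans (le_of_eq (by ring))
  have hdet := PhaseRetrieval.le_abs_det_coeffMatrix (op := op) hkpos hcore
  refine ⟨hdet, fun f => ?_⟩
  have hne : (PhaseRetrieval.coeffMatrix op a τ k m j x).det ≠ 0 :=
    abs_pos.1 (lt_of_lt_of_le (by positivity) hdet)
  exact PhaseRetrieval.existsUnique_of_det_ne_zero hne f
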